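/- Let $K$ be a field and let $L$ be a finite distributive lattice. Write $\alpha\nsim\beta$ if $\alpha,\beta\in L$ are incomparable. Let $K[L]=K[x_\alpha:\alpha\in L]$, let $I_L$ be the ideal generated by the diamond relations $f_{(\alpha,\beta)}=x_\alpha x_\beta-x_{\alpha\vee\beta}x_{\alpha\wedge\beta}$ for $\alpha\nsim\beta$, and let $R[L]=K[L]/I_L$ be the Hibi ring. Let $F=\bigoplus K[L](-2)$ be the free module with one basis element $g_{(\alpha,\beta)}=g_{(\beta,\alpha)}$ for each unordered pair $\{\alpha,\beta\}$ with $\alpha\nsim\beta$, and let $\varphi:F\to K[L]$ be the $K[L]$-linear map with $g_{(\alpha,\beta)}\mapsto f_{(\alpha,\beta)}$, whose image is $I_L$. The first syzygy of $R[L]$ is the submodule $\ker\varphi\subseteq F$. In what follows $\alpha,\beta_1,\beta_2\in L$ always satisfy $\alpha\nsim\beta_1$ and $\alpha\nsim\beta_2$. (Strip type) If $\alpha\vee\beta_1\ne\alpha\vee\beta_2$, $\alpha\wedge\beta_1=\alpha\wedge\beta_2$, $\beta_1\le\beta_2$, $\beta_1\le\alpha\vee\beta_2$, $\beta_1\ge\alpha\wedge\beta_2$,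 $\beta_2\nsim\alpha\vee\beta_1$ and $\beta_2\ge\alpha\wedge\beta_1$, put $$S_1=-x_{\beta_2}g_{(\alpha,\beta_1)}+x_{\beta_1}g_{(\alpha,\beta_2)}-x_{\alpha\wedge\beta_1}g_{(\beta_2,\alpha\vee\beta_1)},$$ $$S_2=x_{\alpha\vee\beta_2}g_{(\alpha,\beta_1)}-x_{\alpha\vee\beta_1}g_{(\alpha,\beta_2)}+x_{\alpha}g_{(\beta_2,\alpha\vee\beta_1)}.$$ ($L$-type) If $\alpha\wedge\beta_1\ne\alpha\wedge\beta_2$, $\alpha\vee\beta_1\ne\alpha\vee\beta_2$, $\beta_1\le\beta_2$, $\beta_1\le\alpha\vee\beta_2$, $\beta_1\nsim\alpha\wedge\beta_2$, $\beta_2\nsim\alpha\vee\beta_1$ and $\beta_2\ge\alpha\wedge\beta_1$, put $$\Lambda=-x_{\beta_2}g_{(\alpha,\beta_1)}+x_{\beta_1}g_{(\alpha,\beta_2)}+x_{\alpha\vee\beta_2}g_{(\beta_1,\alpha\wedge\beta_2)}-x_{\alpha\wedge\beta_1}g_{(\beta_2,\alpha\vee\beta_1)}.$$ (Box type) If $\alpha\wedge\beta_1\ne\alpha\wedge\beta_2$,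 $\alpha\vee\beta_1\ne\alpha\vee\beta_2$, $\beta_1\nsim\beta_2$, $\beta_1\le\alpha\vee\beta_2$, $\beta_1\ge\alpha\wedge\beta_2$, $\beta_2\nsim\alpha\vee\beta_1$ and $\beta_2\nsim\alpha\wedge\beta_1$, put $$B_1=-x_{\beta_2}g_{(\alpha,\beta_1)}+x_{\beta_1}g_{(\alpha,\beta_2)}-x_{\alpha\vee\beta_1}g_{(\beta_2,\alpha\wedge\beta_1)}-x_{\alpha\wedge\beta_2}g_{(\alpha\vee\beta_1,\beta_1\vee\beta_2)},$$ $$B_2=-x_{\beta_1}g_{(\alpha,\beta_2)}+x_{\alpha}g_{(\beta_1,\beta_2)}+x_{\beta_1\vee\beta_2}g_{(\alpha,\beta_1\wedge\beta_2)}+x_{\alpha\wedge\beta_2}g_{(\alpha\vee\beta_1,\beta_1\vee\beta_2)}.$$ Theorem. For all integers $m,n\ge 0$, let $L=G(m,n)=C_{m+1}\times C_{n+1}$ be the $m\times n$ grid lattice, the product (with componentwise order) of chains with $m+1$ and $n+1$ elements. Then the first syzygy $\ker\varphi$ of $R[G(m,n)]$ is equal to the $K[L]$-submodule of $F$ generated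 by all strip type syzygies $S_1,S_2$, all $L$-type syzygies $\Lambda$ and all box type syzygies $B_1,B_2$ of $G(m,n)$. In particular, no diamond type generators $f_{(\alpha_2,\beta_2)}g_{(\alpha_1,\beta_1)}-f_{(\alpha_1,\beta_1)}g_{(\alpha_2,\beta_2)}$ are needed. -/

import Mathlib

noncomputable section

namespace HibiSyzygy

open MvPolynomial

section Lattice

variable {L : Type*} [DistribLattice L]

/-- `a ≁ b`: the elements `a` and `b` are not comparable. -/
abbrev Incomp (a b : L) : Prop := IncompRel (· ≤ ·) a b

variable (L) in
/-- The diamonds of `L`: unordered pairs `{α, β}` of incomparable elements. -/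
abbrev Diamond : Type _ := {s : Sym2 L // ∃ a b : L, Incomp a b ∧ s = s(a, b)}

/-- The diamond `(α, β) = (β, α)`. -/
def diamond (a b : L) (h : Incomp a b) : Diamond L := ⟨s(a, b), a, b, h, rfl⟩

/-- The configuration of a strip: a sublattice with the six elements
`α ⊓ β₁ = α ⊓ β₂, α, β₁, β₂, α ⊔ β₁, α ⊔ β₂`. -/
structure IsStrip (α β₁ β₂ : L) : Prop where
  inc₁ : Incomp α β₁
  inc₂ : Incomp α β₂
  sup_ne : α ⊔ β₁ ≠ α ⊔ β₂
  inf_eq : α ⊓ β₁ = α ⊓ β₂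
  le : β₁ ≤ β₂
  le_sup : β₁ ≤ α ⊔ β₂
  inf_le : α ⊓ β₂ ≤ β₁
  inc_sup : Incomp β₂ (α ⊔ β₁)
  inf_le' : α ⊓ β₁ ≤ β₂

/-- The configuration of an `L`-shape: a sublattice with the eight elements
`α ⊓ β₁, α ⊓ β₂, β₁, α, β₁ ⊔ (α ⊓ β₂) = β₂ ⊓ (α ⊔ β₁), α ⊔ β₁, β₂, α ⊔ β₂`. -/
structure IsLShape (α β₁ β₂ : L) : Prop where
  inc₁ : Incomp α β₁
  inc₂ : Incomp α β₂
  inf_ne : α ⊓ β₁ ≠ α ⊓ β₂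
  sup_ne : α ⊔ β₁ ≠ α ⊔ β₂
  le : β₁ ≤ β₂
  le_sup : β₁ ≤ α ⊔ β₂
  inc_inf : Incomp β₁ (α ⊓ β₂)
  inc_sup : Incomp β₂ (α ⊔ β₁)
  inf_le : α ⊓ β₁ ≤ β₂

/-- The configuration of a box: a sublattice with the nine elements
`α ⊓ β₂, α ⊓ β₁, β₁ ⊓ β₂, α, β₁, β₂, α ⊔ β₁, β₁ ⊔ β₂, α ⊔ β₂`. -/
structure IsBox (α β₁ β₂ : L) : Prop where
  inc₁ : Incomp α β₁
  inc₂ : Incomp α β₂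
  inf_ne : α ⊓ β₁ ≠ α ⊓ β₂
  sup_ne : α ⊔ β₁ ≠ α ⊔ β₂
  inc : Incomp β₁ β₂
  le_sup : β₁ ≤ α ⊔ β₂
  inf_le : α ⊓ β₂ ≤ β₁
  inc_sup : Incomp β₂ (α ⊔ β₁)
  inc_inf : Incomp β₂ (α ⊓ β₁)

theorem IsBox.inc_sup_sup {α β₁ β₂ : L} (h : IsBox α β₁ β₂) :
    Incomp (α ⊔ β₁) (β₁ ⊔ β₂) := by
  refine ⟨fun hle => h.inc₁.1 ?_, fun hle => h.inc_sup.1 (le_sup_right.trans hle)⟩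
  calc α = α ⊓ (β₁ ⊔ β₂) := (inf_eq_left.2 (le_sup_left.trans hle)).symm
    _ = (α ⊓ β₁) ⊔ (α ⊓ β₂) := inf_sup_left _ _ _
    _ ≤ β₁ := sup_le inf_le_right h.inf_le

theorem IsBox.inc_inf_inf {α β₁ β₂ : L} (h : IsBox α β₁ β₂) :
    Incomp α (β₁ ⊓ β₂) := by
  refine ⟨fun hle => h.inc₁.1 (hle.trans inf_le_left), fun hle => h.inc₁.2 ?_⟩
  calc β₁ = β₁ ⊓ (α ⊔ β₂) := (inf_eq_left.2 h.le_sup).symm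
    _ = (β₁ ⊓ α) ⊔ (β₁ ⊓ β₂) := inf_sup_left _ _ _
    _ ≤ α := sup_le inf_le_right hle

end Lattice

section Syzygy

variable (K : Type*) [Field K] (L : Type*) [DistribLattice L]

/-- The Hibi ideal `I_L`, generated by all `x_α x_β - x_{α ⊔ β} x_{α ⊓ β}` with `α ≁ β`. -/
def hibiIdeal : Ideal (MvPolynomial L K) :=
  Ideal.span {f | ∃ a b : L, Incomp a b ∧ f = X a * X b - X (a ⊔ b) * X (a ⊓ b)}

/-- The Hibi ring `R[L] = K[L] / I_L`. -/
abbrev HibiRing : Type _ := MvPolynomial L K ⧸ hibiIdeal K L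

variable {L} in
/-- The diamond relation `f_(α, β) = x_α x_β - x_{α ⊔ β} x_{α ⊓ β}`. -/
def diamondRel (d : Diamond L) : MvPolynomial L K :=
  Sym2.lift ⟨fun a b => X a * X b - X (a ⊔ b) * X (a ⊓ b), fun a b => by
    simp only [mul_comm (X a) (X b), sup_comm a b, inf_comm a b]⟩ d.1

/-- The free `K[L]`-module with one basis element `g_(α, β)` for each diamond. -/
abbrev FreeMod : Type _ := Diamond L →₀ MvPolynomial L K

/-- The map `φ : ⨁ K[L](-2) → K[L]`, `g_(α, β) ↦ f_(α, β)`, the first differential in the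
resolution of `R[L]`. -/
def phi : FreeMod K L →ₗ[MvPolynomial L K] MvPolynomial L K :=
  Finsupp.linearCombination (MvPolynomial L K) (diamondRel K)

/-- The image of `φ` is the Hibi ideal, so that `coker φ = R[L]`. -/
theorem range_phi : LinearMap.range (phi K L) = hibiIdeal K L := by
  rw [phi, Finsupp.range_linearCombination, hibiIdeal, Ideal.span]
  congr 1
  ext f
  constructor
  · rintro ⟨⟨_, a, b, h, rfl⟩, rfl⟩
    exact ⟨a, b, h, rfl⟩
  · rintro ⟨a, b, h, rfl⟩
    exact ⟨diamond a b h, rfl⟩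

/-- The first syzygy of the Hibi ring: the kernel of `φ`. -/
def firstSyzygy : Submodule (MvPolynomial L K) (FreeMod K L) :=
  LinearMap.ker (phi K L)

variable {L}

/-- The basis element `g_(α, β)`. -/
def g (a b : L) (h : Incomp a b) : FreeMod K L := Finsupp.single (diamond a b h) 1

/-- `S₁ = -x_{β₂} g_(α,β₁) + x_{β₁} g_(α,β₂) - x_{α ⊓ β₁} g_(β₂, α ⊔ β₁)`. -/
def stripSyz₁ {α β₁ β₂ : L} (h : IsStrip α β₁ β₂) : FreeMod K L :=
  -((X β₂ : MvPolynomial L K) • g K α β₁ h.inc₁)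
    + (X β₁ : MvPolynomial L K) • g K α β₂ h.inc₂
    - (X (α ⊓ β₁) : MvPolynomial L K) • g K β₂ (α ⊔ β₁) h.inc_sup

/-- `S₂ = x_{α ⊔ β₂} g_(α,β₁) - x_{α ⊔ β₁} g_(α,β₂) + x_α g_(β₂, α ⊔ β₁)`. -/
def stripSyz₂ {α β₁ β₂ : L} (h : IsStrip α β₁ β₂) : FreeMod K L :=
  (X (α ⊔ β₂) : MvPolynomial L K) • g K α β₁ h.inc₁
    - (X (α ⊔ β₁) : MvPolynomial L K) • g K α β₂ h.inc₂
    + (X α : MvPolynomial L K) • g K β₂ (α ⊔ β₁) h.inc_sup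

/-- `-x_{β₂} g_(α,β₁) + x_{β₁} g_(α,β₂) + x_{α ⊔ β₂} g_(β₁, α ⊓ β₂)
- x_{α ⊓ β₁} g_(β₂, α ⊔ β₁)`. -/
def lSyz {α β₁ β₂ : L} (h : IsLShape α β₁ β₂) : FreeMod K L :=
  -((X β₂ : MvPolynomial L K) • g K α β₁ h.inc₁)
    + (X β₁ : MvPolynomial L K) • g K α β₂ h.inc₂
    + (X (α ⊔ β₂) : MvPolynomial L K) • g K β₁ (α ⊓ β₂) h.inc_inf
    - (X (α ⊓ β₁) : MvPolynomial L K) • g K β₂ (α ⊔ β₁) h.inc_sup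

/-- `B₁ = -x_{β₂} g_(α,β₁) + x_{β₁} g_(α,β₂) - x_{α ⊔ β₁} g_(β₂, α ⊓ β₁)
- x_{α ⊓ β₂} g_(α ⊔ β₁, β₁ ⊔ β₂)`. -/
def boxSyz₁ {α β₁ β₂ : L} (h : IsBox α β₁ β₂) : FreeMod K L :=
  -((X β₂ : MvPolynomial L K) • g K α β₁ h.inc₁)
    + (X β₁ : MvPolynomial L K) • g K α β₂ h.inc₂
    - (X (α ⊔ β₁) : MvPolynomial L K) • g K β₂ (α ⊓ β₁) h.inc_inf
    - (X (α ⊓ β₂) : MvPolynomial L K) • g K (α ⊔ β₁) (β₁ ⊔ β₂) h.inc_sup_sup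

/-- `B₂ = -x_{β₁} g_(α,β₂) + x_α g_(β₁,β₂) + x_{β₁ ⊔ β₂} g_(α, β₁ ⊓ β₂)
+ x_{α ⊓ β₂} g_(α ⊔ β₁, β₁ ⊔ β₂)`. -/
def boxSyz₂ {α β₁ β₂ : L} (h : IsBox α β₁ β₂) : FreeMod K L :=
  -((X β₁ : MvPolynomial L K) • g K α β₂ h.inc₂)
    + (X α : MvPolynomial L K) • g K β₁ β₂ h.inc
    + (X (β₁ ⊔ β₂) : MvPolynomial L K) • g K α (β₁ ⊓ β₂) h.inc_inf_inf
    + (X (α ⊓ β₂) : MvPolynomial L K) • g K (α ⊔ β₁) (β₁ ⊔ β₂) h.inc_sup_sup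

variable (L)

/-- All strip type syzygies. -/
def stripType : Set (FreeMod K L) :=
  {z | ∃ (α β₁ β₂ : L) (h : IsStrip α β₁ β₂), z = stripSyz₁ K h ∨ z = stripSyz₂ K h}

/-- All `L`-type syzygies. -/
def lType : Set (FreeMod K L) :=
  {z | ∃ (α β₁ β₂ : L) (h : IsLShape α β₁ β₂), z = lSyz K h}

/-- All box type syzygies. -/
def boxType : Set (FreeMod K L) :=
  {z | ∃ (α β₁ β₂ : L) (h : IsBox α β₁ β₂), z = boxSyz₁ K h ∨ z = boxSyz₂ K h}

end Syzygy

/-- The `m × n` grid lattice `G(m, n) = C_{m+1} × C_{n+1}`, a product of two chains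
(with the componentwise order). -/
abbrev Grid (m n : ℕ) : Type := Fin (m + 1) × Fin (n + 1)

end HibiSyzygy

end

noncomputable section

namespace HibiSyzygy

open MvPolynomial

/-! ### Generators: they lie in the kernel of `phi`, and give relations in the quotient. -/

section Generators

variable (K : Type*) [Field K] {L : Type*} [DistribLattice L]

/-! On a grid, `diamondRel` of a diamond is a 2 × 2 minor of the generic matrix, and everything
takes place in the quotient `LinearQuot` of the free module by the listed syzygies. Sending a minor
to the signed class of its basis element, the strip relations say that the Laplace expansion of a 3
× 3 determinant with a repeated row or column vanishes, while the `L` and box relations say that all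
row and column expansions of a genuine 3 × 3 determinant agree (`expansionsAgree`). Equating a row
expansion with a column expansion for five 3 × 3 submatrices yields the Koszul relations
(`minor_koszul`), which is why no diamond type generator is needed.

These identities settle the critical pairs of a rewriting system. Replacing an incomparable pair in
a monomial by its join and meet lowers `monoWeight`, so rewriting terminates; `reduction` records
the classes of the diamonds used on the way. Two rewritings of the same monomial either share a
cell, where a 3 × 3 exchange identity applies, or are disjoint, where the Koszul relation applies.
By induction on weight the recorded class does not depend on the first step (`reductionBelow`). Its
linear extension, composed with `phi`, is the quotient map (`reductionMap_phi`), so whatever `phi`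
kills is zero in the quotient. -/

theorem phi_g (a b : L) (h : Incomp a b) :
    phi K L (g K a b h) = X a * X b - X (a ⊔ b) * X (a ⊓ b) := by
  simp [phi, g, diamondRel, diamond]

theorem g_comm (a b : L) (h : Incomp a b) : g K a b h = g K b a h.symm := by
  unfold g diamond
  congr 2
  exact Sym2.eq_swap

variable (L) in
/-- The submodule generated by the strip, `L` and box type syzygies. -/
def linearSyzygy : Submodule (MvPolynomial L K) (FreeMod K L) :=
  Submodule.span (MvPolynomial L K) (stripType K L ∪ lType K L ∪ boxType K L)

theorem phi_stripSyz₁ {α β₁ β₂ : L} (h : IsStrip α β₁ β₂) : phi K L (stripSyz₁ K h) = 0 := by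
  have h1 : β₂ ⊔ (α ⊔ β₁) = α ⊔ β₂ := by
    rw [sup_left_comm, sup_eq_left.2 h.le]
  have h2 : β₂ ⊓ (α ⊔ β₁) = β₁ := by
    rw [inf_sup_left, inf_eq_right.2 h.le, inf_comm β₂, ← h.inf_eq]
    simp
  simp only [stripSyz₁, map_add, map_sub, map_neg, map_smul, phi_g, smul_eq_mul, h1, h2,
    ← h.inf_eq]
  ring

theorem phi_stripSyz₂ {α β₁ β₂ : L} (h : IsStrip α β₁ β₂) : phi K L (stripSyz₂ K h) = 0 := by
  have h1 : β₂ ⊔ (α ⊔ β₁) = α ⊔ β₂ := by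
    rw [sup_left_comm, sup_eq_left.2 h.le]
  have h2 : β₂ ⊓ (α ⊔ β₁) = β₁ := by
    rw [inf_sup_left, inf_eq_right.2 h.le, inf_comm β₂, ← h.inf_eq]
    simp
  simp only [stripSyz₂, map_add, map_sub, map_smul, phi_g, smul_eq_mul, h1, h2, ← h.inf_eq]
  ring

theorem phi_lSyz {α β₁ β₂ : L} (h : IsLShape α β₁ β₂) : phi K L (lSyz K h) = 0 := by
  have h1 : β₂ ⊔ (α ⊔ β₁) = α ⊔ β₂ := by
    rw [sup_left_comm, sup_eq_left.2 h.le]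
  have h2 : β₂ ⊓ (α ⊔ β₁) = β₁ ⊔ (α ⊓ β₂) := by
    rw [inf_sup_left, inf_eq_right.2 h.le, inf_comm β₂, sup_comm]
  have h3 : β₁ ⊓ (α ⊓ β₂) = α ⊓ β₁ := by
    rw [inf_left_comm, inf_eq_left.2 h.le]
  simp only [lSyz, map_add, map_sub, map_neg, map_smul, phi_g, smul_eq_mul, h1, h2, h3]
  ring

theorem IsBox.sup_sup {α β₁ β₂ : L} (h : IsBox α β₁ β₂) :
    (α ⊔ β₁) ⊔ (β₁ ⊔ β₂) = α ⊔ β₂ := by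
  apply le_antisymm
  · exact sup_le (sup_le le_sup_left h.le_sup) (sup_le h.le_sup le_sup_right)
  · exact sup_le_sup le_sup_left le_sup_right

theorem IsBox.inf_sup {α β₁ β₂ : L} (h : IsBox α β₁ β₂) :
    (α ⊔ β₁) ⊓ (β₁ ⊔ β₂) = β₁ := by
  rw [sup_comm α, ← sup_inf_left, sup_eq_left.2 h.inf_le]

theorem phi_boxSyz₁ {α β₁ β₂ : L} (h : IsBox α β₁ β₂) : phi K L (boxSyz₁ K h) = 0 := by
  have h1 : β₂ ⊔ (α ⊓ β₁) = β₁ ⊔ β₂ := by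
    rw [sup_inf_left, sup_comm β₂, sup_comm β₂, inf_eq_right]
    exact sup_le h.le_sup le_sup_right
  have h2 : β₂ ⊓ (α ⊓ β₁) = α ⊓ β₂ := by
    rw [inf_left_comm, ← inf_assoc, inf_eq_left]
    exact h.inf_le
  simp only [boxSyz₁, map_add, map_sub, map_neg, map_smul, phi_g, smul_eq_mul, h1, h2, h.sup_sup,
    h.inf_sup]
  ring

theorem phi_boxSyz₂ {α β₁ β₂ : L} (h : IsBox α β₁ β₂) : phi K L (boxSyz₂ K h) = 0 := by
  have h1 : α ⊔ (β₁ ⊓ β₂) = α ⊔ β₁ := by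
    rw [sup_inf_left, inf_eq_left]
    exact sup_le le_sup_left h.le_sup
  have h2 : α ⊓ (β₁ ⊓ β₂) = α ⊓ β₂ := by
    rw [inf_left_comm, inf_eq_right]
    exact h.inf_le
  simp only [boxSyz₂, map_add, map_neg, map_smul, phi_g, smul_eq_mul, h1, h2, h.sup_sup,
    h.inf_sup]
  ring

theorem linearSyzygy_le_firstSyzygy : linearSyzygy K L ≤ firstSyzygy K L := by
  refine Submodule.span_le.2 ?_
  rintro z ((⟨α, β₁, β₂, h, rfl | rfl⟩ | ⟨α, β₁, β₂, h, rfl⟩) | ⟨α, β₁, β₂, h, rfl | rfl⟩)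
  · exact phi_stripSyz₁ K h
  · exact phi_stripSyz₂ K h
  · exact phi_lSyz K h
  · exact phi_boxSyz₁ K h
  · exact phi_boxSyz₂ K h

variable (L) in
/-- The free module modulo the strip, `L` and box type syzygies. -/
abbrev LinearQuot : Type _ := FreeMod K L ⧸ linearSyzygy K L

/-- The class of `g_(α, β)` modulo the strip, `L` and box type syzygies. -/
def gbar (a b : L) (h : Incomp a b) : LinearQuot K L := (linearSyzygy K L).mkQ (g K a b h)

theorem gbar_comm (a b : L) (h : Incomp a b) : gbar K a b h = gbar K b a h.symm := by
  rw [gbar, gbar, g_comm]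

variable {K}

theorem mkQ_eq_zero_of_mem {z : FreeMod K L}
    (hz : z ∈ stripType K L ∪ lType K L ∪ boxType K L) : (linearSyzygy K L).mkQ z = 0 :=
  (Submodule.Quotient.mk_eq_zero _).2 (Submodule.subset_span hz)

variable (K) {α β₁ β₂ s t s' t' : L}

/-- Joins and meets enter through equations, so that on a grid each relation can be read off
directly in coordinates. -/
theorem gbar_strip₁ (h : IsStrip α β₁ β₂) (hs : α ⊔ β₁ = s) (ht : α ⊓ β₁ = t)
    (h₁ : Incomp α β₁) (h₂ : Incomp α β₂) (h₃ : Incomp β₂ s) :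
    -((X β₂ : MvPolynomial L K) • gbar K α β₁ h₁) + (X β₁ : MvPolynomial L K) • gbar K α β₂ h₂
      - (X t : MvPolynomial L K) • gbar K β₂ s h₃ = 0 := by
  subst hs ht
  exact mkQ_eq_zero_of_mem (z := stripSyz₁ K h) (.inl (.inl ⟨_, _, _, h, .inl rfl⟩))

theorem gbar_strip₂ (h : IsStrip α β₁ β₂) (hs : α ⊔ β₁ = s) (hs' : α ⊔ β₂ = s')
    (h₁ : Incomp α β₁) (h₂ : Incomp α β₂) (h₃ : Incomp β₂ s) :
    (X s' : MvPolynomial L K) • gbar K α β₁ h₁ - (X s : MvPolynomial L K) • gbar K α β₂ h₂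
      + (X α : MvPolynomial L K) • gbar K β₂ s h₃ = 0 := by
  subst hs hs'
  exact mkQ_eq_zero_of_mem (z := stripSyz₂ K h) (.inl (.inl ⟨_, _, _, h, .inr rfl⟩))

theorem gbar_lShape (h : IsLShape α β₁ β₂) (hs : α ⊔ β₁ = s) (ht : α ⊓ β₁ = t)
    (hs' : α ⊔ β₂ = s') (ht' : α ⊓ β₂ = t')
    (h₁ : Incomp α β₁) (h₂ : Incomp α β₂) (h₃ : Incomp β₁ t') (h₄ : Incomp β₂ s) :
    -((X β₂ : MvPolynomial L K) • gbar K α β₁ h₁) + (X β₁ : MvPolynomial L K) • gbar K α β₂ h₂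
      + (X s' : MvPolynomial L K) • gbar K β₁ t' h₃
      - (X t : MvPolynomial L K) • gbar K β₂ s h₄ = 0 := by
  subst hs ht hs' ht'
  exact mkQ_eq_zero_of_mem (z := lSyz K h) (.inl (.inr ⟨_, _, _, h, rfl⟩))

theorem gbar_box₁ {u : L} (h : IsBox α β₁ β₂) (hs : α ⊔ β₁ = s) (ht : α ⊓ β₁ = t)
    (ht' : α ⊓ β₂ = t') (hu : β₁ ⊔ β₂ = u)
    (h₁ : Incomp α β₁) (h₂ : Incomp α β₂) (h₃ : Incomp β₂ t) (h₄ : Incomp s u) :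
    -((X β₂ : MvPolynomial L K) • gbar K α β₁ h₁) + (X β₁ : MvPolynomial L K) • gbar K α β₂ h₂
      - (X s : MvPolynomial L K) • gbar K β₂ t h₃
      - (X t' : MvPolynomial L K) • gbar K s u h₄ = 0 := by
  subst hs ht ht' hu
  exact mkQ_eq_zero_of_mem (z := boxSyz₁ K h) (.inr ⟨_, _, _, h, .inl rfl⟩)

theorem gbar_box₂ {u v : L} (h : IsBox α β₁ β₂) (hs : α ⊔ β₁ = s)
    (ht' : α ⊓ β₂ = t') (hu : β₁ ⊔ β₂ = u) (hv : β₁ ⊓ β₂ = v)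
    (h₁ : Incomp α β₂) (h₂ : Incomp β₁ β₂) (h₃ : Incomp α v) (h₄ : Incomp s u) :
    -((X β₁ : MvPolynomial L K) • gbar K α β₂ h₁) + (X α : MvPolynomial L K) • gbar K β₁ β₂ h₂
      + (X u : MvPolynomial L K) • gbar K α v h₃
      + (X t' : MvPolynomial L K) • gbar K s u h₄ = 0 := by
  subst hs ht' hu hv
  exact mkQ_eq_zero_of_mem (z := boxSyz₂ K h) (.inr ⟨_, _, _, h, .inr rfl⟩)

end Generators

/-! ### Minors of a generic matrix and their Laplace expansions. -/

section Minors

variable {R C : Type*} [LinearOrder R] [LinearOrder C]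

theorem incomp_prod_iff {i k : R} {j l : C} :
    Incomp (i, j) (k, l) ↔ i < k ∧ l < j ∨ k < i ∧ j < l := by
  simp only [Incomp, IncompRel, Prod.mk_le_mk, not_and_or, not_le]
  grind

theorem isStrip_row {i k : R} {b d f : C} (hik : i < k) (hbd : b < d) (hdf : d < f) :
    IsStrip (k, b) (i, d) (i, f) := by
  have hbf := hbd.trans hdf
  constructor <;>
    simp [incomp_prod_iff, hik, hbd, hdf, hbf, hik.le, hbd.le, hdf.le, hbf.le, hdf.ne]

theorem isStrip_col {a c e : R} {j l : C} (hac : a < c) (hce : c < e) (hjl : j < l) :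
    IsStrip (a, l) (c, j) (e, j) := by
  have hae := hac.trans hce
  constructor <;>
    simp [incomp_prod_iff, hac, hce, hae, hac.le, hce.le, hae.le, hjl, hjl.le, hce.ne]

/-- A 3 × 3 grid carries two `L`-shapes, exchanged by transposition, with `α` at one or the other
end of the antidiagonal. -/
theorem isLShape_upper {a c e : R} {b d f : C} (hac : a < c) (hce : c < e) (hbd : b < d)
    (hdf : d < f) : IsLShape (a, f) (c, b) (e, d) := by
  have hae := hac.trans hce
  have hbf := hbd.trans hdf
  constructor <;>
    simp [incomp_prod_iff, hac, hce, hae, hac.le, hce.le, hae.le, hbd, hdf, hbf, hbd.le, hdf.le,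
      hbf.le, hce.ne, hbd.ne]

theorem isLShape_lower {a c e : R} {b d f : C} (hac : a < c) (hce : c < e) (hbd : b < d)
    (hdf : d < f) : IsLShape (e, b) (a, d) (c, f) := by
  have hae := hac.trans hce
  have hbf := hbd.trans hdf
  constructor <;>
    simp [incomp_prod_iff, hac, hce, hae, hac.le, hce.le, hae.le, hbd, hdf, hbf, hbd.le, hdf.le,
      hbf.le, hdf.ne, hac.ne]

theorem isBox_antidiagonal {a c e : R} {b d f : C} (hac : a < c) (hce : c < e) (hbd : b < d)
    (hdf : d < f) : IsBox (a, f) (c, d) (e, b) := by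
  have hae := hac.trans hce
  have hbf := hbd.trans hdf
  constructor <;>
    simp [incomp_prod_iff, hac, hce, hae, hac.le, hce.le, hae.le, hbd, hdf, hbf, hbd.le, hdf.le,
      hbf.le, hce.ne, hbd.ne']

variable (K : Type*) [Field K]

open Classical in
/-- The class of the signed basis element mapped by `φ` to the minor
`x_(i,j) x_(k,l) - x_(i,l) x_(k,j)`. -/
def minor (i k : R) (j l : C) : LinearQuot K (R × C) :=
  if h : Incomp (i, j) (k, l) then gbar K (i, j) (k, l) h
  else if h : Incomp (i, l) (k, j) then -gbar K (i, l) (k, j) h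
  else 0

theorem minor_of_incomp {i k : R} {j l : C} (h : Incomp (i, j) (k, l)) :
    minor K i k j l = gbar K (i, j) (k, l) h := dif_pos h

theorem minor_of_incomp' {i k : R} {j l : C} (h : Incomp (i, l) (k, j)) :
    minor K i k j l = -gbar K (i, l) (k, j) h := by
  have h' : ¬ Incomp (i, j) (k, l) := by
    rw [incomp_prod_iff] at h ⊢
    grind
  rw [minor, dif_neg h', dif_pos h]

theorem minor_of_lt {i k : R} {j l : C} (hik : i < k) (hjl : j < l) :
    minor K i k j l = -gbar K (i, l) (k, j) (incomp_prod_iff.2 (.inl ⟨hik, hjl⟩)) :=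
  minor_of_incomp' K _

@[simp]
theorem minor_self_row (i : R) (j l : C) : minor K i i j l = 0 := by
  rw [minor, dif_neg (by simp [incomp_prod_iff]), dif_neg (by simp [incomp_prod_iff])]

@[simp]
theorem minor_self_col (i k : R) (j : C) : minor K i k j j = 0 := by
  rw [minor, dif_neg (by simp [incomp_prod_iff]), dif_neg (by simp [incomp_prod_iff])]

theorem minor_swap_col (i k : R) (j l : C) : minor K i k l j = -minor K i k j l := by
  by_cases h : Incomp (i, j) (k, l)
  · rw [minor_of_incomp K h, minor_of_incomp' K h]
  by_cases h' : Incomp (i, l) (k, j)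
  · rw [minor_of_incomp K h', minor_of_incomp' K h', neg_neg]
  · simp [minor, h, h']

theorem minor_swap (i k : R) (j l : C) : minor K k i l j = minor K i k j l := by
  by_cases h : Incomp (i, j) (k, l)
  · rw [minor_of_incomp K h, minor_of_incomp K h.symm, gbar_comm]
  by_cases h' : Incomp (i, l) (k, j)
  · rw [minor_of_incomp' K h', minor_of_incomp' K h'.symm, gbar_comm]
  · rw [minor, dif_neg (fun H => h H.symm), dif_neg (fun H => h' H.symm), minor, dif_neg h,
      dif_neg h']

theorem minor_swap_row (i k : R) (j l : C) : minor K k i j l = -minor K i k j l := by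
  rw [← minor_swap, minor_swap_col]

/-- The expansion along row `r` of the `3 × 3` minor with rows `r, a, c`, up to sign. -/
def rowExp (r a c : R) (b d f : C) : LinearQuot K (R × C) :=
  (X (r, b) : MvPolynomial (R × C) K) • minor K a c d f
    - (X (r, d) : MvPolynomial (R × C) K) • minor K a c b f
    + (X (r, f) : MvPolynomial (R × C) K) • minor K a c b d

/-- The expansion along column `j` of the `3 × 3` minor with columns `j, b, d`, up to sign. -/
def colExp (j : C) (a c e : R) (b d : C) : LinearQuot K (R × C) :=
  (X (a, j) : MvPolynomial (R × C) K) • minor K c e b d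
    - (X (c, j) : MvPolynomial (R × C) K) • minor K a e b d
    + (X (e, j) : MvPolynomial (R × C) K) • minor K a c b d

theorem rowExp_swap_row (r a c : R) (b d f : C) : rowExp K r c a b d f = -rowExp K r a c b d f := by
  simp only [rowExp, minor_swap_row K a c]
  module

theorem rowExp_swap_col₁ (r a c : R) (b d f : C) :
    rowExp K r a c d b f = -rowExp K r a c b d f := by
  simp only [rowExp, minor_swap_col K a c b d]
  module

theorem rowExp_swap_col₂ (r a c : R) (b d f : C) :
    rowExp K r a c b f d = -rowExp K r a c b d f := by
  simp only [rowExp, minor_swap_col K a c d f]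
  module

theorem colExp_swap_col (j : C) (a c e : R) (b d : C) :
    colExp K j a c e d b = -colExp K j a c e b d := by
  simp only [colExp, minor_swap_col K _ _ b d]
  module

theorem colExp_swap_row₁ (j : C) (a c e : R) (b d : C) :
    colExp K j c a e b d = -colExp K j a c e b d := by
  simp only [colExp, minor_swap_row K a c]
  module

theorem colExp_swap_row₂ (j : C) (a c e : R) (b d : C) :
    colExp K j a e c b d = -colExp K j a c e b d := by
  simp only [colExp, minor_swap_row K c e]
  module

theorem forall_of_sorted {α : Type*} [LinearOrder α] {p : α → α → α → Prop}
    (h₁ : ∀ a b c, p a b c → p b a c) (h₂ : ∀ a b c, p a b c → p a c b)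
    (h : ∀ a b c, a ≤ b → b ≤ c → p a b c) (a b c : α) : p a b c := by
  rcases le_total a b with hab | hab <;> rcases le_total b c with hbc | hbc <;>
    rcases le_total a c with hac | hac
  · exact h _ _ _ hab hbc
  · exact h _ _ _ hab hbc
  · exact h₂ _ _ _ (h _ _ _ hac hbc)
  · exact h₂ _ _ _ (h₁ _ _ _ (h _ _ _ hac hab))
  · exact h₁ _ _ _ (h _ _ _ hab hac)
  · exact h₁ _ _ _ (h₂ _ _ _ (h _ _ _ hbc hac))
  · exact h₁ _ _ _ (h₂ _ _ _ (h₁ _ _ _ (h _ _ _ hbc hab)))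
  · exact h₁ _ _ _ (h₂ _ _ _ (h₁ _ _ _ (h _ _ _ hbc hab)))

/-- A determinant with a repeated row vanishes. For sorted columns this is a strip relation:
`stripSyz₁` has its coefficients in the lower row of the strip and `stripSyz₂` in the upper row,
which accounts for the cases `i < k` and `k < i`. -/
theorem rowExp_self (i k : R) : ∀ b d f : C, rowExp K i i k b d f = 0 := by
  refine forall_of_sorted (fun b d f h => ?_) (fun b d f h => ?_) fun b d f hbd hdf => ?_
  · rw [rowExp_swap_col₁, h, neg_zero]
  · rw [rowExp_swap_col₂, h, neg_zero]
  rcases hbd.eq_or_lt with rfl | hbd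
  · simp [rowExp]
  rcases hdf.eq_or_lt with rfl | hdf
  · simp [rowExp]
  have hbf := hbd.trans hdf
  rcases lt_trichotomy i k with hik | rfl | hik
  · have h := gbar_strip₁ K (isStrip_row hik hbd hdf) (s := (k, d)) (t := (i, b))
      (by simp [hik.le, hbd.le]) (by simp [hik.le, hbd.le]) (isStrip_row hik hbd hdf).inc₁
      (isStrip_row hik hbd hdf).inc₂ (by simp [incomp_prod_iff, hik, hdf])
    rw [rowExp, minor_of_lt K hik hdf, minor_of_lt K hik hbf, minor_of_lt K hik hbd,
      gbar_comm K (i, f) (k, b), gbar_comm K (i, d) (k, b)]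
    linear_combination (norm := module) h
  · simp [rowExp]
  · have h := gbar_strip₂ K (isStrip_row hik hbd hdf) (s := (i, d)) (s' := (i, f))
      (by simp [hik.le, hbd.le]) (by simp [hik.le, hbf.le]) (isStrip_row hik hbd hdf).inc₁
      (isStrip_row hik hbd hdf).inc₂ (by simp [incomp_prod_iff, hik, hdf])
    rw [rowExp, minor_swap_row K k i d f, minor_swap_row K k i b f, minor_swap_row K k i b d,
      minor_of_lt K hik hdf, minor_of_lt K hik hbf, minor_of_lt K hik hbd,
      gbar_comm K (k, f) (i, b), gbar_comm K (k, d) (i, b)]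
    linear_combination (norm := module) h

theorem colExp_self (j l : C) : ∀ a c e : R, colExp K j a c e j l = 0 := by
  refine forall_of_sorted (fun a c e h => ?_) (fun a c e h => ?_) fun a c e hac hce => ?_
  · rw [colExp_swap_row₁, h, neg_zero]
  · rw [colExp_swap_row₂, h, neg_zero]
  rcases hac.eq_or_lt with rfl | hac
  · simp [colExp]
  rcases hce.eq_or_lt with rfl | hce
  · simp [colExp]
  have hae := hac.trans hce
  rcases lt_trichotomy j l with hjl | rfl | hjl
  · have h := gbar_strip₁ K (isStrip_col hac hce hjl) (s := (c, l)) (t := (a, j))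
      (by simp [hac.le, hjl.le]) (by simp [hac.le, hjl.le]) (isStrip_col hac hce hjl).inc₁
      (isStrip_col hac hce hjl).inc₂ (by simp [incomp_prod_iff, hce, hjl])
    rw [colExp, minor_of_lt K hce hjl, minor_of_lt K hae hjl, minor_of_lt K hac hjl,
      gbar_comm K (c, l) (e, j)]
    linear_combination (norm := module) h
  · simp [colExp]
  · have h := gbar_strip₂ K (isStrip_col hac hce hjl) (s := (c, j)) (s' := (e, j))
      (by simp [hac.le, hjl.le]) (by simp [hae.le, hjl.le]) (isStrip_col hac hce hjl).inc₁
      (isStrip_col hac hce hjl).inc₂ (by simp [incomp_prod_iff, hce, hjl])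
    rw [colExp, minor_swap_col K _ _ l j, minor_swap_col K _ _ l j, minor_swap_col K _ _ l j,
      minor_of_lt K hce hjl, minor_of_lt K hae hjl, minor_of_lt K hac hjl,
      gbar_comm K (c, j) (e, l)]
    linear_combination (norm := module) h

/-- All expansions of the `3 × 3` minor with rows `a, c, e` and columns `b, d, f` agree modulo the
strip, `L` and box type syzygies. -/
def ExpansionsAgree (a c e : R) (b d f : C) : Prop :=
  ∃ D : LinearQuot K (R × C), rowExp K a c e b d f = D ∧ rowExp K c a e b d f = -D ∧
    rowExp K e a c b d f = D ∧ colExp K b a c e d f = D ∧ colExp K d a c e b f = -D ∧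
    colExp K f a c e b d = D

/-- The alternating sum of the row expansions equals that of the column expansions term by term, so
only four of the five equalities are independent. The two `L` and two box relations supply them. -/
theorem expansionsAgree_of_lt {a c e : R} {b d f : C} (hac : a < c) (hce : c < e) (hbd : b < d)
    (hdf : d < f) : ExpansionsAgree K a c e b d f := by
  have hae := hac.trans hce
  have hbf := hbd.trans hdf
  have hU := isLShape_upper hac hce hbd hdf
  have hL := isLShape_lower hac hce hbd hdf
  have hB := isBox_antidiagonal hac hce hbd hdf
  have h1 := gbar_lShape K hU (s := (c, f)) (t := (a, b)) (s' := (e, f)) (t' := (a, d))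
    (by simp [hac.le, hbf.le]) (by simp [hac.le, hbf.le]) (by simp [hae.le, hdf.le])
    (by simp [hae.le, hdf.le]) hU.inc₁ hU.inc₂ (by simp [incomp_prod_iff, hac, hbd])
    (by simp [incomp_prod_iff, hce, hdf])
  have h2 := gbar_lShape K hL (s := (e, d)) (t := (a, b)) (s' := (e, f)) (t' := (c, b))
    (by simp [hae.le, hbd.le]) (by simp [hae.le, hbd.le]) (by simp [hce.le, hbf.le])
    (by simp [hce.le, hbf.le]) hL.inc₁ hL.inc₂ (by simp [incomp_prod_iff, hac, hbd])
    (by simp [incomp_prod_iff, hce, hdf])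
  have h3 := gbar_box₁ K hB (s := (c, f)) (t := (a, d)) (t' := (a, b)) (u := (e, d))
    (by simp [hac.le, hdf.le]) (by simp [hac.le, hdf.le]) (by simp [hae.le, hbf.le])
    (by simp [hce.le, hbd.le]) hB.inc₁ hB.inc₂ (by simp [incomp_prod_iff, hae, hbd])
    (by simp [incomp_prod_iff, hce, hdf])
  have h4 := gbar_box₂ K hB (s := (c, f)) (t' := (a, b)) (u := (e, d)) (v := (c, b))
    (by simp [hac.le, hdf.le]) (by simp [hae.le, hbf.le])
    (by simp [hce.le, hbd.le]) (by simp [hce.le, hbd.le]) hB.inc₂ hB.inc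
    (by simp [incomp_prod_iff, hac, hbf]) (by simp [incomp_prod_iff, hce, hdf])
  simp only [gbar_comm K (c, b) (a, d), gbar_comm K (e, d) (c, f), gbar_comm K (e, b) (a, d),
    gbar_comm K (e, b) (c, f)] at h1 h2 h3 h4
  refine ⟨_, rfl, ?_, ?_, ?_, ?_, ?_⟩ <;>
    simp only [rowExp, colExp, minor_of_lt K hac hbd, minor_of_lt K hac hbf,
      minor_of_lt K hac hdf, minor_of_lt K hae hbd, minor_of_lt K hae hbf, minor_of_lt K hae hdf,
      minor_of_lt K hce hbd, minor_of_lt K hce hbf, minor_of_lt K hce hdf]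
  · linear_combination (norm := module) h2 - h1 - h4
  · linear_combination (norm := module) h3 + h4 - h2
  · linear_combination (norm := module) h3 + h4 + h1 - h2
  · linear_combination (norm := module) -h4
  · linear_combination (norm := module) -h2

theorem expansionsAgree (a c e : R) (b d f : C) : ExpansionsAgree K a c e b d f := by
  revert b d f
  refine forall_of_sorted (p := fun a c e => ∀ b d f : C, ExpansionsAgree K a c e b d f)
    (fun a c e h b d f => ?_) (fun a c e h b d f => ?_) (fun a c e hac hce => ?_) a c e
  · obtain ⟨D, h1, h2, h3, h4, h5, h6⟩ := h b d f
    refine ⟨-D, h2, ?_, ?_, ?_, ?_, ?_⟩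
    · rw [h1, neg_neg]
    · rw [rowExp_swap_row, h3]
    · rw [colExp_swap_row₁, h4]
    · rw [colExp_swap_row₁, h5]
    · rw [colExp_swap_row₁, h6]
  · obtain ⟨D, h1, h2, h3, h4, h5, h6⟩ := h b d f
    refine ⟨-D, ?_, ?_, h2, ?_, ?_, ?_⟩
    · rw [rowExp_swap_row, h1]
    · rw [h3, neg_neg]
    · rw [colExp_swap_row₂, h4]
    · rw [colExp_swap_row₂, h5]
    · rw [colExp_swap_row₂, h6]
  refine forall_of_sorted (fun b d f h => ?_) (fun b d f h => ?_) fun b d f hbd hdf => ?_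
  · obtain ⟨D, h1, h2, h3, h4, h5, h6⟩ := h
    refine ⟨-D, ?_, ?_, ?_, h5, ?_, ?_⟩
    · rw [rowExp_swap_col₁, h1]
    · rw [rowExp_swap_col₁, h2]
    · rw [rowExp_swap_col₁, h3]
    · rw [h4, neg_neg]
    · rw [colExp_swap_col, h6]
  · obtain ⟨D, h1, h2, h3, h4, h5, h6⟩ := h
    refine ⟨-D, ?_, ?_, ?_, ?_, ?_, h5⟩
    · rw [rowExp_swap_col₂, h1]
    · rw [rowExp_swap_col₂, h2]
    · rw [rowExp_swap_col₂, h3]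
    · rw [colExp_swap_col, h4]
    · rw [h6, neg_neg]
  have hrow : ∀ (i k : R), rowExp K k i k b d f = 0 := fun i k => by
    rw [rowExp_swap_row, rowExp_self, neg_zero]
  have hcol : ∀ (j l : C), colExp K l a c e j l = 0 := fun j l => by
    rw [colExp_swap_col, colExp_self, neg_zero]
  -- With a repeated row or column every expansion vanishes, either by cancellation or by the strip
  -- relations, so the common value is 0.
  rcases hac.eq_or_lt with rfl | hac
  · exact ⟨0, by simp [rowExp_self], by simp [rowExp_self], by simp [rowExp], by simp [colExp],
      by simp [colExp], by simp [colExp]⟩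
  rcases hce.eq_or_lt with rfl | hce
  · exact ⟨0, by simp [rowExp], by simp [hrow], by simp [hrow], by simp [colExp],
      by simp [colExp], by simp [colExp]⟩
  rcases hbd.eq_or_lt with rfl | hbd
  · exact ⟨0, by simp [rowExp], by simp [rowExp], by simp [rowExp], by simp [colExp_self],
      by simp [colExp_self], by simp [colExp]⟩
  rcases hdf.eq_or_lt with rfl | hdf
  · exact ⟨0, by simp [rowExp], by simp [rowExp], by simp [rowExp], by simp [colExp],
      by simp [hcol], by simp [hcol]⟩
  exact expansionsAgree_of_lt K hac hce hbd hdf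

/-- Row `e` and column `d` expand to opposite values, and the terms with coefficient `X (e, d)`
cancel in their sum. -/
theorem minor_exchange (a c e : R) (b d f : C) :
    (X (e, f) : MvPolynomial (R × C) K) • minor K a c b d
      + (X (a, d) : MvPolynomial (R × C) K) • minor K c e b f
      + (X (e, b) : MvPolynomial (R × C) K) • minor K a c d f
      = (X (c, d) : MvPolynomial (R × C) K) • minor K a e b f := by
  obtain ⟨D, -, -, h3, -, h5, -⟩ := expansionsAgree K a c e b d f
  rw [rowExp] at h3
  rw [colExp] at h5
  linear_combination (norm := module) h3 + h5

/-- The Koszul relations between minors are consequences of the strip, `L` and box type syzygies. -/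
theorem minor_koszul (i k r s : R) (j l p q : C) :
    (X (r, p) * X (s, q) - X (r, q) * X (s, p) : MvPolynomial (R × C) K) • minor K i k j l
      = (X (i, j) * X (k, l) - X (i, l) * X (k, j) : MvPolynomial (R × C) K)
        • minor K r s p q := by
  -- Each 3 × 3 submatrix omits one row and one column of the 4 × 4 array on rows `i, k, r, s` and
  -- columns `j, l, p, q`. The multiplier of its row-equals-column identity is the entry where these
  -- meet.
  obtain ⟨D1, a1, -, -, -, -, a2⟩ := expansionsAgree K i r s l p q
  obtain ⟨D2, -, b1, -, -, -, b2⟩ := expansionsAgree K i k s j l p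
  obtain ⟨D3, c1, -, -, -, -, c2⟩ := expansionsAgree K k r s j l q
  obtain ⟨D4, d1, -, -, -, -, d2⟩ := expansionsAgree K i r s j p q
  obtain ⟨D5, -, e1, -, -, -, e2⟩ := expansionsAgree K i k r j l p
  rw [rowExp] at a1 b1 c1 d1 e1
  rw [colExp] at a2 b2 c2 d2 e2
  linear_combination (norm := module) (X (k, j) : MvPolynomial (R × C) K) • (a1 - a2)
    + (X (r, q) : MvPolynomial (R × C) K) • (-b1 - b2)
    + (X (i, p) : MvPolynomial (R × C) K) • (c1 - c2)
    - (X (k, l) : MvPolynomial (R × C) K) • (d1 - d2)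
    - (X (s, q) : MvPolynomial (R × C) K) • (-e1 - e2)

end Minors

/-- Cancellation in the free commutative monoid, used to classify how two factorisations of a
monomial overlap. -/
theorem single_add_eq_single_add {σ : Type*} {a b : σ} {x y : σ →₀ ℕ}
    (h : Finsupp.single a 1 + x = Finsupp.single b 1 + y) :
    a = b ∧ x = y ∨ ∃ z, x = Finsupp.single b 1 + z ∧ y = Finsupp.single a 1 + z := by
  classical
  by_cases hab : a = b
  · subst hab
    exact .inl ⟨rfl, add_left_cancel h⟩
  · have hx : Finsupp.single b 1 ≤ x := by
      rw [Finsupp.single_le_iff]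
      have := DFunLike.congr_fun h b
      simp [hab] at this
      omega
    refine .inr ⟨x - Finsupp.single b 1, (add_tsub_cancel_of_le hx).symm, ?_⟩
    refine add_left_cancel (a := Finsupp.single b 1) ?_
    rw [← h, add_left_comm, add_tsub_cancel_of_le hx]

/-! ### Rewriting monomials of the grid: termination, confluence and conclusion. -/

section Grid

variable {m n : ℕ}

/-- A weight on the cells of the grid; replacing an incomparable pair by its join and meet lowers
the total weight. -/
def cellWeight (a : Grid m n) : ℕ := a.1 * (n - a.2)

/-- The total weight of a monomial. -/
def monoWeight : (Grid m n →₀ ℕ) →+ ℕ := Finsupp.weight cellWeight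

theorem monoWeight_single (a : Grid m n) : monoWeight (Finsupp.single a 1) = cellWeight a := by
  simp [monoWeight, Finsupp.weight_single]

theorem cellWeight_swap_lt {a c : Fin (m + 1)} {b d : Fin (n + 1)} (h : Incomp (a, b) (c, d)) :
    cellWeight (a, d) + cellWeight (c, b) < cellWeight (a, b) + cellWeight (c, d) := by
  simp only [cellWeight]
  rcases incomp_prod_iff.1 h with ⟨h1, h2⟩ | ⟨h1, h2⟩
  · obtain ⟨x, hx⟩ := Nat.exists_eq_add_of_lt (Fin.lt_def.1 h1)
    obtain ⟨y, hy⟩ : ∃ y, n - d.val = n - b.val + y + 1 := ⟨b - d - 1, by omega⟩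
    rw [hx, hy]
    nlinarith
  · obtain ⟨x, hx⟩ := Nat.exists_eq_add_of_lt (Fin.lt_def.1 h1)
    obtain ⟨y, hy⟩ : ∃ y, n - b.val = n - d.val + y + 1 := ⟨d - b - 1, by omega⟩
    rw [hx, hy]
    nlinarith

/-- When two rewritings share the cell `(a, b)`, their results are joined through a cyclic
permutation of the three column indices. At least one of the two cyclic permutations stays below the
original weight, as the induction requires. -/
theorem cellWeight_rotate_lt {a c e : Fin (m + 1)} {b d f : Fin (n + 1)}
    (h : Incomp (a, b) (c, d)) (h' : Incomp (a, b) (e, f)) :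
    cellWeight (a, d) + cellWeight (c, f) + cellWeight (e, b) <
        cellWeight (a, b) + cellWeight (c, d) + cellWeight (e, f) ∨
      cellWeight (a, f) + cellWeight (e, d) + cellWeight (c, b) <
        cellWeight (a, b) + cellWeight (c, d) + cellWeight (e, f) := by
  have key : ∀ {a c e : ℤ} {b d f : ℤ}, (a < c ∧ b < d ∨ c < a ∧ d < b) →
      (a < e ∧ b < f ∨ e < a ∧ f < b) →
      a * d + c * f + e * b < a * b + c * d + e * f ∨
        a * f + e * d + c * b < a * b + c * d + e * f := by
    intro a c e b d f h1 h2
    rcases h1 with ⟨h1, h3⟩ | ⟨h1, h3⟩ <;> rcases h2 with ⟨h2, h4⟩ | ⟨h2, h4⟩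
    · rcases le_total c e with h | h
      · left
        linarith [mul_pos (sub_pos.2 h1) (sub_pos.2 h3),
          mul_nonneg (sub_nonneg.2 h) (sub_pos.2 h4).le]
      · right
        linarith [mul_pos (sub_pos.2 h2) (sub_pos.2 h4),
          mul_nonneg (sub_nonneg.2 h) (sub_pos.2 h3).le]
    · left
      linarith [mul_pos (sub_pos.2 h1) (sub_pos.2 h3), mul_pos (sub_pos.2 h2) (sub_pos.2 h4),
        mul_pos (sub_pos.2 h1) (sub_pos.2 h4)]
    · left
      linarith [mul_pos (sub_pos.2 h1) (sub_pos.2 h3), mul_pos (sub_pos.2 h2) (sub_pos.2 h4),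
        mul_pos (sub_pos.2 h1) (sub_pos.2 h4)]
    · rcases le_total c e with h | h
      · right
        linarith [mul_pos (sub_pos.2 h2) (sub_pos.2 h4),
          mul_nonneg (sub_nonneg.2 h) (sub_pos.2 h3).le]
      · left
        linarith [mul_pos (sub_pos.2 h1) (sub_pos.2 h3),
          mul_nonneg (sub_nonneg.2 h) (sub_pos.2 h4).le]
  -- Reversing the column order turns incomparability into strict order in both coordinates and the
  -- weight into a product.
  rw [incomp_prod_iff] at h h'
  have := key (a := a.val) (c := c.val) (e := e.val) (b := (n - b.val : ℕ)) (d := (n - d.val : ℕ))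
    (f := (n - f.val : ℕ)) (by omega) (by omega)
  simp only [cellWeight]
  exact_mod_cast this

variable (K : Type*) [Field K]

open Classical in
/-- The class of a chain of diamond relations leading from `x^u` to a standard monomial. -/
def reduction (u : Grid m n →₀ ℕ) : LinearQuot K (Grid m n) :=
  if h : ∃ t : (Grid m n →₀ ℕ) × Grid m n × Grid m n, Incomp t.2.1 t.2.2 ∧
      u = t.1 + Finsupp.single t.2.1 1 + Finsupp.single t.2.2 1 then
    (monomial h.choose.1 1 : MvPolynomial (Grid m n) K) •
        minor K h.choose.2.1.1 h.choose.2.2.1 h.choose.2.1.2 h.choose.2.2.2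
      + reduction (h.choose.1 + Finsupp.single (h.choose.2.1.1, h.choose.2.2.2) 1
        + Finsupp.single (h.choose.2.2.1, h.choose.2.1.2) 1)
  else 0
termination_by monoWeight u
decreasing_by
  have := cellWeight_swap_lt h.choose_spec.1
  conv_rhs => rw [h.choose_spec.2]
  simp only [map_add, monoWeight_single]
  change cellWeight (h.choose.2.1.1, h.choose.2.2.2) + cellWeight (h.choose.2.2.1, h.choose.2.1.2) <
    cellWeight h.choose.2.1 + cellWeight h.choose.2.2 at this
  omega

/-- `reduction` is compatible with the replacement of `x_(a,b) x_(c,d)` by `x_(a,d) x_(c,b)` in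
`x^w x_(a,b) x_(c,d)`. -/
def ReductionStep (w : Grid m n →₀ ℕ) (a c : Fin (m + 1)) (b d : Fin (n + 1)) : Prop :=
  reduction K (w + Finsupp.single (a, b) 1 + Finsupp.single (c, d) 1) =
    (monomial w 1 : MvPolynomial (Grid m n) K) • minor K a c b d
      + reduction K (w + Finsupp.single (a, d) 1 + Finsupp.single (c, b) 1)

/-- Compatibility of `reduction` with all diamond relations below a given weight. -/
def ReductionBelow (m n N : ℕ) : Prop :=
  ∀ (w : Grid m n →₀ ℕ) (a c : Fin (m + 1)) (b d : Fin (n + 1)), Incomp (a, b) (c, d) →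
    monoWeight (w + Finsupp.single (a, b) 1 + Finsupp.single (c, d) 1) < N →
    ReductionStep K w a c b d

variable {K}

/-- Once both monomials are below `N`, the exchange may also go upward or be trivial: the signs
built into `minor` absorb all three cases. -/
theorem ReductionBelow.step {N : ℕ} (H : ReductionBelow K m n N) {u v : Grid m n →₀ ℕ}
    (hu : monoWeight u < N) (hv : monoWeight v < N)
    (w : Grid m n →₀ ℕ) (a c : Fin (m + 1)) (b d : Fin (n + 1))
    (hu' : u = w + Finsupp.single (a, b) 1 + Finsupp.single (c, d) 1)
    (hv' : v = w + Finsupp.single (a, d) 1 + Finsupp.single (c, b) 1) :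
    reduction K u =
      (monomial w 1 : MvPolynomial (Grid m n) K) • minor K a c b d + reduction K v := by
  by_cases h : Incomp (a, b) (c, d)
  · rw [hu'] at hu ⊢
    rw [hv']
    exact H w a c b d h hu
  by_cases h' : Incomp (a, d) (c, b)
  · rw [hv'] at hv ⊢
    rw [hu', H w a c d b h' hv, minor_swap_col K a c d b]
    module
  have hac : a = c ∨ b = d := by
    rw [incomp_prod_iff] at h h'
    grind
  have huv : u = v := by
    rw [hu', hv']
    rcases hac with rfl | rfl
    · rw [add_right_comm]
    · rfl
  rw [huv]
  rcases hac with rfl | rfl <;> simp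

theorem ReductionBelow.shared {N : ℕ} (H : ReductionBelow K m n N) {z : Grid m n →₀ ℕ}
    {a c e : Fin (m + 1)} {b d f : Fin (n + 1)} (h : Incomp (a, b) (c, d))
    (h' : Incomp (a, b) (e, f))
    (hN : monoWeight (z + Finsupp.single (a, b) 1 + Finsupp.single (c, d) 1
      + Finsupp.single (e, f) 1) = N) :
    (monomial (z + Finsupp.single (e, f) 1) 1 : MvPolynomial (Grid m n) K) • minor K a c b d
      + reduction K (z + Finsupp.single (e, f) 1 + Finsupp.single (a, d) 1
        + Finsupp.single (c, b) 1) =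
    (monomial (z + Finsupp.single (c, d) 1) 1 : MvPolynomial (Grid m n) K) • minor K a e b f
      + reduction K (z + Finsupp.single (c, d) 1 + Finsupp.single (a, f) 1
        + Finsupp.single (e, b) 1) := by
  have h1 := cellWeight_swap_lt h
  have h2 := cellWeight_swap_lt h'
  -- Interchanging `(c, d)` and `(e, f)` interchanges the two cyclic permutations.
  wlog hmid : cellWeight (a, d) + cellWeight (c, f) + cellWeight (e, b) <
        cellWeight (a, b) + cellWeight (c, d) + cellWeight (e, f) generalizing c d e f
  · refine (this h' h ?_ h2 h1 ?_).symm
    · rw [← hN, add_right_comm]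
    · have := (cellWeight_rotate_lt h h').resolve_left hmid
      omega
  subst hN
  simp only [map_add, monoWeight_single] at H
  have e1 := H.step (u := z + Finsupp.single (e, f) 1 + Finsupp.single (a, d) 1
        + Finsupp.single (c, b) 1)
      (v := z + Finsupp.single (a, d) 1 + Finsupp.single (c, f) 1 + Finsupp.single (e, b) 1)
      (by simp only [map_add, monoWeight_single]; omega)
      (by simp only [map_add, monoWeight_single]; omega)
      (z + Finsupp.single (a, d) 1) c e b f (by abel) (by abel)
  have e2 := H.step
      (u := z + Finsupp.single (a, d) 1 + Finsupp.single (c, f) 1 + Finsupp.single (e, b) 1)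
      (v := z + Finsupp.single (c, d) 1 + Finsupp.single (a, f) 1
        + Finsupp.single (e, b) 1)
      (by simp only [map_add, monoWeight_single]; omega)
      (by simp only [map_add, monoWeight_single]; omega)
      (z + Finsupp.single (e, b) 1) a c d f (by abel) (by abel)
  rw [e1, e2]
  simp only [monomial_add_single, pow_one, mul_smul]
  -- The four exchanges form a closed loop, whose discrepancy is exactly the exchange identity times
  -- the common monomial.
  have q := congrArg (fun y => (monomial z 1 : MvPolynomial (Grid m n) K) • y)
    (minor_exchange K a c e b d f)
  simp only [smul_add] at q
  rw [← q]
  abel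

/-- The two rewritings commute: both results lead to the monomial with both pairs replaced, and the
discrepancy is a Koszul relation. -/
theorem ReductionBelow.disjoint {N : ℕ} (H : ReductionBelow K m n N) {z : Grid m n →₀ ℕ}
    {i k r s : Fin (m + 1)} {j l p q : Fin (n + 1)} (h : Incomp (i, j) (k, l))
    (h' : Incomp (r, p) (s, q))
    (hN : monoWeight (z + Finsupp.single (i, j) 1 + Finsupp.single (k, l) 1
      + Finsupp.single (r, p) 1 + Finsupp.single (s, q) 1) = N) :
    (monomial (z + Finsupp.single (r, p) 1 + Finsupp.single (s, q) 1) 1 :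
        MvPolynomial (Grid m n) K) • minor K i k j l
      + reduction K (z + Finsupp.single (r, p) 1 + Finsupp.single (s, q) 1
        + Finsupp.single (i, l) 1 + Finsupp.single (k, j) 1) =
    (monomial (z + Finsupp.single (i, j) 1 + Finsupp.single (k, l) 1) 1 :
        MvPolynomial (Grid m n) K) • minor K r s p q
      + reduction K (z + Finsupp.single (i, j) 1 + Finsupp.single (k, l) 1
        + Finsupp.single (r, q) 1 + Finsupp.single (s, p) 1) := by
  have h1 := cellWeight_swap_lt h
  have h2 := cellWeight_swap_lt h'
  subst hN
  simp only [map_add, monoWeight_single] at H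
  have e1 := H.step
      (u := z + Finsupp.single (r, p) 1 + Finsupp.single (s, q) 1
        + Finsupp.single (i, l) 1 + Finsupp.single (k, j) 1)
      (v := z + Finsupp.single (i, l) 1 + Finsupp.single (k, j) 1
        + Finsupp.single (r, q) 1 + Finsupp.single (s, p) 1)
      (by simp only [map_add, monoWeight_single]; omega)
      (by simp only [map_add, monoWeight_single]; omega)
      (z + Finsupp.single (i, l) 1 + Finsupp.single (k, j) 1) r s p q (by abel) (by abel)
  have e2 := H.step
      (u := z + Finsupp.single (i, j) 1 + Finsupp.single (k, l) 1
        + Finsupp.single (r, q) 1 + Finsupp.single (s, p) 1)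
      (v := z + Finsupp.single (i, l) 1 + Finsupp.single (k, j) 1
        + Finsupp.single (r, q) 1 + Finsupp.single (s, p) 1)
      (by simp only [map_add, monoWeight_single]; omega)
      (by simp only [map_add, monoWeight_single]; omega)
      (z + Finsupp.single (r, q) 1 + Finsupp.single (s, p) 1) i k j l (by abel) (by abel)
  rw [e1, e2]
  simp only [monomial_add_single, pow_one]
  linear_combination (norm := module) (monomial z 1 : MvPolynomial (Grid m n) K) •
    (minor_koszul K i k r s j l p q)

theorem ReductionBelow.confluent {N : ℕ} (H : ReductionBelow K m n N) {w w' : Grid m n →₀ ℕ}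
    {i k r s : Fin (m + 1)} {j l p q : Fin (n + 1)} (h : Incomp (i, j) (k, l))
    (h' : Incomp (r, p) (s, q))
    (hN : monoWeight (w + Finsupp.single (i, j) 1 + Finsupp.single (k, l) 1) = N)
    (hw : w + Finsupp.single (i, j) 1 + Finsupp.single (k, l) 1
      = w' + Finsupp.single (r, p) 1 + Finsupp.single (s, q) 1) :
    (monomial w 1 : MvPolynomial (Grid m n) K) • minor K i k j l
      + reduction K (w + Finsupp.single (i, l) 1 + Finsupp.single (k, j) 1) =
    (monomial w' 1 : MvPolynomial (Grid m n) K) • minor K r s p q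
      + reduction K (w' + Finsupp.single (r, q) 1 + Finsupp.single (s, p) 1) := by
  have hw₀ : Finsupp.single (i, j) 1 + (Finsupp.single (k, l) 1 + w)
      = Finsupp.single (r, p) 1 + (Finsupp.single (s, q) 1 + w') := by
    convert hw using 1 <;> abel
  -- Seven overlaps arise: the same pair in either order, one shared cell in four positions, and
  -- disjoint pairs.
  rcases single_add_eq_single_add hw₀ with ⟨h1, h2⟩ | ⟨z, h1, h2⟩
  · obtain ⟨rfl, rfl⟩ := Prod.mk.inj h1
    rcases single_add_eq_single_add h2 with ⟨h3, rfl⟩ | ⟨y, rfl, rfl⟩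
    · obtain ⟨rfl, rfl⟩ := Prod.mk.inj h3
      rfl
    · have := H.shared (z := y) h h' (by rw [← hN]; congr 1; abel)
      convert this using 3 <;> abel_nf
  rcases single_add_eq_single_add h1 with ⟨h3, rfl⟩ | ⟨y, rfl, rfl⟩
  · obtain ⟨rfl, rfl⟩ := Prod.mk.inj h3
    rcases single_add_eq_single_add h2 with ⟨h4, rfl⟩ | ⟨y, rfl, rfl⟩
    · obtain ⟨rfl, rfl⟩ := Prod.mk.inj h4
      rw [minor_swap, add_right_comm]
    · have := H.shared (z := y) h.symm h' (by rw [← hN]; congr 1; abel)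
      rw [minor_swap] at this
      convert this using 3 <;> abel_nf
  · rcases single_add_eq_single_add h2 with ⟨h4, rfl⟩ | ⟨x, rfl, h4⟩
    · obtain ⟨rfl, rfl⟩ := Prod.mk.inj h4
      have := H.shared (z := y) h h'.symm (by rw [← hN]; congr 1; abel)
      rw [minor_swap K r s] at this
      convert this using 3 <;> abel_nf
    · rcases single_add_eq_single_add h4 with ⟨h5, rfl⟩ | ⟨x', rfl, rfl⟩
      · obtain ⟨rfl, rfl⟩ := Prod.mk.inj h5
        have := H.shared (z := y) h.symm h'.symm (by rw [← hN]; congr 1; abel)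
        rw [minor_swap K i k, minor_swap K r k] at this
        convert this using 3 <;> abel_nf
      · have := H.disjoint (z := x') h h' (by rw [← hN]; congr 1; abel)
        convert this using 3 <;> abel_nf

variable (K)

theorem reductionBelow (N : ℕ) : ReductionBelow K m n N := by
  induction N with
  | zero => exact fun w a c b d _ hw => absurd hw (Nat.not_lt_zero _)
  | succ N ih =>
    intro w a c b d h hw
    rcases Nat.lt_succ_iff_lt_or_eq.1 hw with hw | hw
    · exact ih w a c b d h hw
    have ht : ∃ t : (Grid m n →₀ ℕ) × Grid m n × Grid m n, Incomp t.2.1 t.2.2 ∧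
        w + Finsupp.single (a, b) 1 + Finsupp.single (c, d) 1
          = t.1 + Finsupp.single t.2.1 1 + Finsupp.single t.2.2 1 := ⟨(w, (a, b), (c, d)), h, rfl⟩
    rw [ReductionStep, reduction, dif_pos ht]
    -- At weight exactly `N`, confluence compares the given first step with the one picked by choice
    -- in `reduction`.
    exact (ih.confluent h ht.choose_spec.1 hw ht.choose_spec.2).symm

/-- The `K`-linear extension of `reduction`. -/
def reductionMap : MvPolynomial (Grid m n) K →ₗ[K] LinearQuot K (Grid m n) :=
  (basisMonomials (Grid m n) K).constr K (reduction K)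

theorem reductionMap_monomial (u : Grid m n →₀ ℕ) (c : K) :
    reductionMap K (monomial u c) = c • reduction K u := by
  have : (monomial u c : MvPolynomial (Grid m n) K) = c • basisMonomials (Grid m n) K u := by
    simp [smul_monomial]
  rw [this, map_smul, reductionMap, Module.Basis.constr_basis]

theorem diamond_cases (d : Diamond (Grid m n)) : ∃ a c b e, ∃ h : Incomp (a, b) (c, e),
    d = diamond (a, b) (c, e) h ∧
      diamondRel K d = X (a, b) * X (c, e) - X (a, e) * X (c, b) := by
  obtain ⟨_, ⟨a, b⟩, ⟨c, e⟩, h, rfl⟩ := d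
  refine ⟨a, c, b, e, h, rfl, ?_⟩
  rw [diamondRel, Sym2.lift_mk]
  rcases incomp_prod_iff.1 h with ⟨h1, h2⟩ | ⟨h1, h2⟩
  · simp [h1.le, h2.le, mul_comm]
  · simp [h1.le, h2.le]

/-- `reductionMap` is only `K`-linear, so the check runs over scalar multiples of a monomial times a
basis element. There `phi` gives a difference of two monomials one rewriting step apart, and their
reductions differ by the class of that step. -/
theorem reductionMap_phi (z : FreeMod K (Grid m n)) :
    reductionMap K (phi K _ z) = (linearSyzygy K (Grid m n)).mkQ z := by
  induction z using Finsupp.induction_linear with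
  | zero => simp
  | add x y hx hy => rw [map_add, map_add, map_add, hx, hy]
  | single d f =>
    induction f using MvPolynomial.induction_on' with
    | add p q hp hq => rw [Finsupp.single_add, map_add, map_add, map_add, hp, hq]
    | monomial w c =>
      obtain ⟨a, c', b, e, h, rfl, hrel⟩ := diamond_cases K d
      have h1 : phi K _ (Finsupp.single (diamond (a, b) (c', e) h) (monomial w c))
          = monomial (w + Finsupp.single (a, b) 1 + Finsupp.single (c', e) 1) c
            - monomial (w + Finsupp.single (a, e) 1 + Finsupp.single (c', b) 1) c := by
        rw [phi, Finsupp.linearCombination_single, hrel]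
        simp only [monomial_add_single, pow_one, smul_eq_mul]
        ring
      have h2 : Finsupp.single (diamond (a, b) (c', e) h) (monomial w c)
          = c • (monomial w 1 : MvPolynomial (Grid m n) K) • g K (a, b) (c', e) h := by
        simp [g, smul_monomial]
      have h3 : ReductionStep K w a c' b e := reductionBelow K _ w a c' b e h (Nat.lt_succ_self _)
      rw [h1, h2, map_sub, reductionMap_monomial, reductionMap_monomial, h3,
        minor_of_incomp K h, ← smul_sub, add_sub_cancel_right]
      rfl

theorem firstSyzygy_grid : firstSyzygy K (Grid m n) = linearSyzygy K (Grid m n) := by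
  refine le_antisymm (fun z hz => ?_) (linearSyzygy_le_firstSyzygy K)
  rw [← Submodule.Quotient.mk_eq_zero, ← Submodule.mkQ_apply, ← reductionMap_phi,
    LinearMap.mem_ker.1 hz, map_zero]

end Grid

end HibiSyzygy

end

theorem mainTheorem7 (K : Type*) [Field K] (m n : ℕ) :
    HibiSyzygy.firstSyzygy K (HibiSyzygy.Grid m n) =
      Submodule.span (MvPolynomial (HibiSyzygy.Grid m n) K)
        (HibiSyzygy.stripType K (HibiSyzygy.Grid m n) ∪
          HibiSyzygy.lType K (HibiSyzygy.Grid m n) ∪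
          HibiSyzygy.boxType K (HibiSyzygy.Grid m n)) := by
  exact HibiSyzygy.firstSyzygy_grid K
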